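/- Let $G$ be a finite group and $T$ a $G$-Tambara functor, given by commutative rings $T(G/H)$ for $H\le G$ with restrictions $r^H_K$, transfers $t^H_K$, norms $N^H_K$ ($K\le H$) and conjugations $c_{g,H}\colon T(G/H)\cong T(G/gHg^{-1})$ satisfying the usual axioms (functoriality, compatibility with conjugation, the additive and multiplicative double coset formulas, Frobenius reciprocity, and Tambara reciprocity for sums and for transfers). A Tambara ideal $I\trianglelefteq T$ is a family of ideals $I(G/H)\subseteq T(G/H)$ stable under restrictions, transfers, norms and conjugations; ideals are ordered by levelwise inclusion. The product $IJ$ is the Tambara ideal generated by the levelwise products $I(G/H)J(G/H)$. A Tambara ideal $P$ is prime if $1\notin P(G/G)$ and $IJ\subseteq P$ implies $I\subseteq P$ or $J\subseteq P$. The Nakaoka spectrum $\mathrm{Spec}_{\mathrm{Nak}}(T)$ is the set of primes, with the topology for which the sets $\{P\mid x\in P(G/H)\}$ ($H\le G$, $x\in T(G/H)$) form a subbasis of closed sets. The radical $\sqrt I$ is the Tambara ideal with $\sqrt I(G/H)=\{x\in T(G/H)\mid \langle x\rangle^n\subseteq I\text{ for some }n\ge 1\}$, where $\langle x\rangle$ is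 the Tambara ideal generated by $x$; $I$ is radical if $I=\sqrt I$. Let $\mathrm{RadId}_G(T)$ be the frame of radical Tambara ideals ordered by inclusion. The quotient $T/I$ has levels $T(G/H)/I(G/H)$. (1) Let $I\trianglelefteq T$ be any Tambara ideal, with quotient map $\pi\colon T\to T/I$. Then $\bar J\mapsto\pi^{-1}(\bar J)$ is an isomorphism of frames $$\mathrm{RadId}_G(T/I)\;\cong\;{\uparrow}\sqrt I:=\{J\in\mathrm{RadId}_G(T)\mid \sqrt I\subseteq J\},$$ with inverse $J\mapsto\sqrt{\pi_*(J)}$, where $\pi_*(J)$ is the Tambara ideal of $T/I$ generated by the images $\pi_H(J(G/H))$. Moreover $V(I)=V(\sqrt I)$, where $V(I):=\{P\in\mathrm{Spec}_{\mathrm{Nak}}(T)\mid I\subseteq P\}$ carries the subspace topology, and $Q\mapsto\pi^{-1}(Q)$ is a homeomorphism $\mathrm{Spec}_{\mathrm{Nak}}(T/I)\cong V(I)$. (2) Let $\mathfrak N(T)=\sqrt 0$ and $T_{\mathrm{red}}=T/\mathfrak N(T)$, with projection $\pi\colon T\to T_{\mathrm{red}}$. Then $\bar J\mapsto\pi^{-1}(\bar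 J)$, with inverse $J\mapsto\sqrt{\pi_*(J)}$, is an isomorphism of frames $\mathrm{RadId}_G(T_{\mathrm{red}})\cong\mathrm{RadId}_G(T)$, and $Q\mapsto\pi^{-1}(Q)$ is a homeomorphism $\mathrm{Spec}_{\mathrm{Nak}}(T_{\mathrm{red}})\cong\mathrm{Spec}_{\mathrm{Nak}}(T)$. -/

import Mathlib

universe u v w

namespace Tambara

section Combinatorics

variable {G : Type v} [Group G]

/-- The conjugate subgroup `g H g⁻¹`. -/
abbrev cj (g : G) (H : Subgroup G) : Subgroup G := H.map (MulAut.conj g).toMonoidHom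

theorem mem_cj {g x : G} {H : Subgroup G} : x ∈ cj g H ↔ g⁻¹ * x * g ∈ H := by
  constructor
  · rintro ⟨h, hh, rfl⟩
    simpa [mul_assoc] using hh
  · intro h
    exact ⟨_, h, by simp [mul_assoc]⟩

/-- The left cosets `L / H`, for subgroups `H ≤ L` of `G`. -/
abbrev Cosets (H L : Subgroup G) : Type v := L ⧸ H.subgroupOf L

/-- Labellings `L / H → Fin n` of the cosets, with `L` acting by `(l • f) b = f (l⁻¹ • b)`. -/
def Labelling (H L : Subgroup G) (n : ℕ) : Type v := Cosets H L → Fin n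

instance (H L : Subgroup G) (n : ℕ) : MulAction L (Labelling H L n) where
  smul l f := fun b => f (l⁻¹ • b)
  one_smul f := by funext b; change f _ = f b; simp
  mul_smul x y f := by
    funext b
    change f ((x * y)⁻¹ • b) = f (y⁻¹ • x⁻¹ • b)
    rw [mul_inv_rev, mul_smul]

theorem subgroupOf_mono {K H : Subgroup G} (h : K ≤ H) (L : Subgroup G) :
    K.subgroupOf L ≤ H.subgroupOf L := Subgroup.comap_mono h

/-- Sections `s : L / H → L / K` of the projection `L / K → L / H`, for `K ≤ H ≤ L`; here `L` acts
by `(l • s) b = l • s (l⁻¹ • b)`. -/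
def CosetSection {K H : Subgroup G} (h : K ≤ H) (L : Subgroup G) : Type v :=
  {s : Cosets H L → Cosets K L //
    ∀ b, Subgroup.quotientMapOfLE (subgroupOf_mono h L) (s b) = b}

theorem quotientMapOfLE_smul {L : Type v} [Group L] {A B : Subgroup L} (h : A ≤ B) (l : L)
    (x : L ⧸ A) :
    Subgroup.quotientMapOfLE h (l • x) = l • Subgroup.quotientMapOfLE h x := by
  induction x using QuotientGroup.induction_on with
  | H z => rfl

instance {K H : Subgroup G} (h : K ≤ H) (L : Subgroup G) : MulAction L (CosetSection h L) where
  smul l s := ⟨fun b => l • s.1 (l⁻¹ • b), fun b => by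
    change Subgroup.quotientMapOfLE (subgroupOf_mono h L) (l • s.1 (l⁻¹ • b)) = b
    rw [quotientMapOfLE_smul, s.2, smul_inv_smul]⟩
  one_smul s := by
    apply Subtype.ext; funext b
    change (1 : L) • s.1 ((1 : L)⁻¹ • b) = s.1 b
    simp
  mul_smul x y s := by
    apply Subtype.ext; funext b
    change (x * y) • s.1 ((x * y)⁻¹ • b) = x • y • s.1 (y⁻¹ • x⁻¹ • b)
    rw [mul_inv_rev, mul_smul, mul_smul]

/-- The stabilizer in `L` of a point of an `L`-set, as a subgroup of `G`. -/
def stab (L : Subgroup G) {X : Type v} [MulAction L X] (x : X) : Subgroup G :=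
  (MulAction.stabilizer L x).map L.subtype

theorem stab_le (L : Subgroup G) {X : Type v} [MulAction L X] (x : X) : stab L x ≤ L :=
  Subgroup.map_subtype_le _

/-- The double cosets `L \ K / H` for subgroups `L, H` of `K`. -/
abbrev DCosets (L H K : Subgroup G) : Type v :=
  DoubleCoset.Quotient (L.subgroupOf K : Set K) (H.subgroupOf K : Set K)

/-- The orbits `L \ X` of an `L`-set `X`. -/
abbrev Orbits (L : Subgroup G) (X : Type v) [MulAction L X] : Type v :=
  MulAction.orbitRel.Quotient L X

/-- If `s` is a section and `s (γ H) = δ K`, then the stabilizer of `s` and `γ H` is contained in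
the stabilizer `δ K δ⁻¹` of `δ K`. -/
theorem stab_inf_cj_le {K H : Subgroup G} (h : K ≤ H) (L : Subgroup G) (s : CosetSection h L)
    (γ : L) :
    stab L s ⊓ cj (γ : G) H ≤ cj ((s.1 (QuotientGroup.mk γ)).out : G) K := by
  rintro x ⟨⟨l, hl, rfl⟩, hx⟩
  have hx' := mem_cj.1 hx
  rw [mem_cj]
  have h1 : l⁻¹ • (QuotientGroup.mk γ : Cosets H L) = QuotientGroup.mk γ := by
    change (QuotientGroup.mk (l⁻¹ * γ) : Cosets H L) = _
    rw [QuotientGroup.eq, Subgroup.mem_subgroupOf]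
    simpa [mul_assoc] using hx'
  have h2 : l • s.1 (QuotientGroup.mk γ) = s.1 (QuotientGroup.mk γ) := by
    have hs : l • s = s := hl
    have := congrFun (congrArg Subtype.val hs) (QuotientGroup.mk γ)
    change l • s.1 (l⁻¹ • QuotientGroup.mk γ) = _ at this
    rwa [h1] at this
  set d := (s.1 (QuotientGroup.mk γ)).out with hd
  have h3 : s.1 (QuotientGroup.mk γ) = QuotientGroup.mk d := (QuotientGroup.out_eq' _).symm
  rw [h3] at h2
  have h4 : (QuotientGroup.mk (l * d) : Cosets K L) = QuotientGroup.mk d := h2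
  have h5 := QuotientGroup.eq.1 h4.symm
  rw [Subgroup.mem_subgroupOf] at h5
  simpa [mul_assoc] using h5

instance [Finite G] (H L : Subgroup G) (n : ℕ) : Finite (Labelling H L n) :=
  inferInstanceAs (Finite (Cosets H L → Fin n))

instance [Finite G] {K H : Subgroup G} (h : K ≤ H) (L : Subgroup G) : Finite (CosetSection h L) :=
  inferInstanceAs (Finite (Subtype _))

instance [Finite G] (L H K : Subgroup G) : Finite (DCosets L H K) :=
  inferInstanceAs (Finite (_root_.Quotient _))

noncomputable instance [Finite G] (L H K : Subgroup G) : Fintype (DCosets L H K) :=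
  Fintype.ofFinite _

noncomputable instance (L : Subgroup G) (X : Type v) [MulAction L X] [Finite X] :
    Fintype (Orbits L X) :=
  Fintype.ofFinite _

end Combinatorics

/-- A `G`-Tambara functor, described on orbits: `obj H` is the ring `T(G/H)`, `res`, `tr`, `norm`
are restriction, transfer and norm along `K ≤ H`, and `conj g` is `c_{g,H} : T(G/H) ≅ T(G/gHg⁻¹)`
(the target is any subgroup `K` with a proof of `K = gHg⁻¹`, so that no transports are needed).

Sums over double cosets or orbits are evaluated at chosen representatives; by the remaining axioms
the summands do not depend on the choice. -/
structure TambaraFunctor (G : Type v) [Group G] [Finite G] where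
  obj : Subgroup G → Type u
  [ring : ∀ H, CommRing (obj H)]
  res : ∀ {K H : Subgroup G}, K ≤ H → (obj H →+* obj K)
  tr : ∀ {K H : Subgroup G}, K ≤ H → (obj K →+ obj H)
  norm : ∀ {K H : Subgroup G}, K ≤ H → (obj K →* obj H)
  conj : ∀ (g : G) {H K : Subgroup G}, K = cj g H → (obj H ≃+* obj K)
  -- functoriality
  res_refl : ∀ {H : Subgroup G} (x : obj H), res le_rfl x = x
  res_trans : ∀ {L K H : Subgroup G} (hLK : L ≤ K) (hKH : K ≤ H) (x : obj H),
    res hLK (res hKH x) = res (hLK.trans hKH) x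
  tr_refl : ∀ {H : Subgroup G} (x : obj H), tr le_rfl x = x
  tr_trans : ∀ {L K H : Subgroup G} (hLK : L ≤ K) (hKH : K ≤ H) (x : obj L),
    tr hKH (tr hLK x) = tr (hLK.trans hKH) x
  norm_refl : ∀ {H : Subgroup G} (x : obj H), norm le_rfl x = x
  norm_trans : ∀ {L K H : Subgroup G} (hLK : L ≤ K) (hKH : K ≤ H) (x : obj L),
    norm hKH (norm hLK x) = norm (hLK.trans hKH) x
  conj_mul : ∀ (g h : G) {H K L : Subgroup G} (hK : K = cj h H) (hL : L = cj g K)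
    (hL' : L = cj (g * h) H) (x : obj H), conj g hL (conj h hK x) = conj (g * h) hL' x
  conj_of_mem : ∀ {h : G} {H : Subgroup G}, h ∈ H → ∀ (e : H = cj h H) (x : obj H),
    conj h e x = x
  -- compatibility with conjugation
  conj_res : ∀ (g : G) {K H K' H' : Subgroup G} (h : K ≤ H) (h' : K' ≤ H')
    (hK : K' = cj g K) (hH : H' = cj g H) (x : obj H),
    conj g hK (res h x) = res h' (conj g hH x)
  conj_norm : ∀ (g : G) {K H K' H' : Subgroup G} (h : K ≤ H) (h' : K' ≤ H')
    (hK : K' = cj g K) (hH : H' = cj g H) (x : obj K),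
    conj g hH (norm h x) = norm h' (conj g hK x)
  conj_tr : ∀ (g : G) {K H K' H' : Subgroup G} (h : K ≤ H) (h' : K' ≤ H')
    (hK : K' = cj g K) (hH : H' = cj g H) (x : obj K),
    conj g hH (tr h x) = tr h' (conj g hK x)
  -- additive double coset formula
  res_tr : ∀ {H L K : Subgroup G} (hH : H ≤ K) (hL : L ≤ K) (x : obj H),
    res hL (tr hH x) = ∑ γ : DCosets L H K,
      tr (inf_le_left : L ⊓ cj (γ.out : G) H ≤ L)
        (res (inf_le_right : L ⊓ cj (γ.out : G) H ≤ cj (γ.out : G) H) (conj (γ.out : G) rfl x))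
  -- multiplicative double coset formula
  res_norm : ∀ {H L K : Subgroup G} (hH : H ≤ K) (hL : L ≤ K) (x : obj H),
    res hL (norm hH x) = ∏ γ : DCosets L H K,
      norm (inf_le_left : L ⊓ cj (γ.out : G) H ≤ L)
        (res (inf_le_right : L ⊓ cj (γ.out : G) H ≤ cj (γ.out : G) H) (conj (γ.out : G) rfl x))
  -- Frobenius reciprocity
  frobenius : ∀ {K H : Subgroup G} (h : K ≤ H) (x : obj H) (y : obj K),
    tr h (res h x * y) = x * tr h y
  -- Tambara reciprocity for sums: the norm from `H` to `L` of `a₁ + ⋯ + aₙ` is a sum over the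
  -- `L`-orbits of labellings `f : L / H → {1, …, n}`
  norm_sum : ∀ {H L : Subgroup G} (h : H ≤ L) (n : ℕ) (a : Fin n → obj H),
    norm h (∑ i, a i) = ∑ f : Orbits L (Labelling H L n),
      tr (stab_le L f.out) (∏ γ : DCosets (stab L f.out) H L,
        norm (inf_le_left : stab L f.out ⊓ cj (γ.out : G) H ≤ stab L f.out)
          (res (inf_le_right : stab L f.out ⊓ cj (γ.out : G) H ≤ cj (γ.out : G) H)
            (conj (γ.out : G) rfl (a (f.out (QuotientGroup.mk γ.out))))))
  -- Tambara reciprocity for transfers: the norm from `H` to `L` of a transfer from `K` is a sum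
  -- over the `L`-orbits of sections `s` of `L / K → L / H`; here `δ K = s (γ H)`
  norm_tr : ∀ {K H L : Subgroup G} (hKH : K ≤ H) (hHL : H ≤ L) (x : obj K),
    norm hHL (tr hKH x) = ∑ s : Orbits L (CosetSection hKH L),
      tr (stab_le L s.out) (∏ γ : DCosets (stab L s.out) H L,
        norm (inf_le_left : stab L s.out ⊓ cj (γ.out : G) H ≤ stab L s.out)
          (res (stab_inf_cj_le hKH L s.out γ.out)
            (conj ((s.out.1 (QuotientGroup.mk γ.out)).out : G) rfl x)))

attribute [instance] TambaraFunctor.ring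

variable {G : Type v} [Group G] [Finite G]

/-- Morphisms of Tambara functors: levelwise ring homomorphisms commuting with all structure
maps. -/
structure TambaraHom (T : TambaraFunctor.{u} G) (S : TambaraFunctor.{w} G) where
  app : ∀ H, T.obj H →+* S.obj H
  app_res : ∀ {K H : Subgroup G} (h : K ≤ H) (x : T.obj H),
    app K (T.res h x) = S.res h (app H x)
  app_tr : ∀ {K H : Subgroup G} (h : K ≤ H) (x : T.obj K),
    app H (T.tr h x) = S.tr h (app K x)
  app_norm : ∀ {K H : Subgroup G} (h : K ≤ H) (x : T.obj K),
    app H (T.norm h x) = S.norm h (app K x)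
  app_conj : ∀ (g : G) {H K : Subgroup G} (e : K = cj g H) (x : T.obj H),
    app K (T.conj g e x) = S.conj g e (app H x)

/-- Tambara ideals. -/
@[ext]
structure TambaraIdeal (T : TambaraFunctor.{u} G) where
  level : ∀ H, Ideal (T.obj H)
  res_mem : ∀ {K H : Subgroup G} (h : K ≤ H) {x : T.obj H}, x ∈ level H → T.res h x ∈ level K
  tr_mem : ∀ {K H : Subgroup G} (h : K ≤ H) {x : T.obj K}, x ∈ level K → T.tr h x ∈ level H
  norm_mem : ∀ {K H : Subgroup G} (h : K ≤ H) {x : T.obj K}, x ∈ level K → T.norm h x ∈ level H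
  map_conj : ∀ (g : G) {H K : Subgroup G} (e : K = cj g H),
    T.conj g e '' (level H : Set (T.obj H)) = level K

section Basics

variable {T : TambaraFunctor.{u} G}

theorem TambaraFunctor.norm_zero {K H : Subgroup G} (h : K ≤ H) : T.norm h 0 = 0 := by
  have := T.norm_sum h 0 (fun i => i.elim0)
  rw [Finset.univ_eq_empty, Finset.sum_empty] at this
  rw [this]
  apply Finset.sum_eq_zero
  intro f _
  exact (f.out (QuotientGroup.mk 1) : Fin 0).elim0

/-- Invariance under conjugation only has to be checked in one direction. -/
theorem image_conj_of_mem (lev : ∀ H, Set (T.obj H))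
    (hc : ∀ (g : G) {H K : Subgroup G} (e : K = cj g H) {x : T.obj H}, x ∈ lev H →
      T.conj g e x ∈ lev K)
    (g : G) {H K : Subgroup G} (e : K = cj g H) : T.conj g e '' lev H = lev K := by
  apply Set.Subset.antisymm
  · rintro _ ⟨x, hx, rfl⟩
    exact hc g e hx
  · intro y hy
    have e' : H = cj g⁻¹ K := by
      subst e; ext z; simp [mul_assoc]
    have e1 : K = cj (g * g⁻¹) K := by ext z; simp
    refine ⟨T.conj g⁻¹ e' y, hc _ e' hy, ?_⟩
    rw [T.conj_mul g g⁻¹ e' e e1]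
    have e2 : K = cj 1 K := by ext z; simp
    have : ∀ (k : G) (_ : k = 1) (e1 : K = cj k K), T.conj k e1 y = y := by
      rintro k rfl e1
      exact T.conj_of_mem K.one_mem e1 y
    exact this _ (mul_inv_cancel g) e1

namespace TambaraIdeal

theorem conj_mem (I : TambaraIdeal T) (g : G) {H K : Subgroup G} (e : K = cj g H) {x : T.obj H}
    (hx : x ∈ I.level H) : T.conj g e x ∈ I.level K := by
  have : T.conj g e x ∈ T.conj g e '' (I.level H : Set (T.obj H)) := ⟨x, hx, rfl⟩
  rw [I.map_conj g e] at this
  exact this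

/-- Ideals are ordered by levelwise inclusion. -/
instance : PartialOrder (TambaraIdeal T) where
  le I J := ∀ H, I.level H ≤ J.level H
  le_refl _ _ := le_rfl
  le_trans _ _ _ h h' H := (h H).trans (h' H)
  le_antisymm I J h h' := by
    ext1; funext H; exact le_antisymm (h H) (h' H)

/-- Levelwise intersections. -/
instance : InfSet (TambaraIdeal T) where
  sInf S :=
    { level := fun H => ⨅ I ∈ S, I.level H
      res_mem := fun h x hx => by
        simp only [Submodule.mem_iInf] at hx ⊢
        exact fun I hI => I.res_mem h (hx I hI)
      tr_mem := fun h x hx => by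
        simp only [Submodule.mem_iInf] at hx ⊢
        exact fun I hI => I.tr_mem h (hx I hI)
      norm_mem := fun h x hx => by
        simp only [Submodule.mem_iInf] at hx ⊢
        exact fun I hI => I.norm_mem h (hx I hI)
      map_conj := image_conj_of_mem _ (fun g H K e x hx => by
        simp only [SetLike.mem_coe, Submodule.mem_iInf] at hx ⊢
        exact fun I hI => I.conj_mem g e (hx I hI)) }

theorem mem_sInf {S : Set (TambaraIdeal T)} {H : Subgroup G} {x : T.obj H} :
    x ∈ (sInf S).level H ↔ ∀ I ∈ S, x ∈ I.level H := by
  change x ∈ (⨅ I ∈ S, I.level H : Ideal (T.obj H)) ↔ _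
  simp only [Submodule.mem_iInf]

instance : CompleteLattice (TambaraIdeal T) :=
  completeLatticeOfInf _ (fun _ => ⟨fun I hI _ _ hx => mem_sInf.1 hx I hI,
    fun _ hJ H _ hx => mem_sInf.2 fun _ hI => hJ hI H hx⟩)

/-- The Tambara ideal generated by a family of sets of elements. -/
def span (X : ∀ H, Set (T.obj H)) : TambaraIdeal T := sInf {I | ∀ H, X H ⊆ I.level H}

/-- The Tambara ideal `⟨x⟩` generated by one element `x ∈ T(G/H)`. -/
def principal {H : Subgroup G} (x : T.obj H) : TambaraIdeal T := sInf {I | x ∈ I.level H}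

/-- The product of Tambara ideals: the ideal generated by the levelwise products. -/
def mul (I J : TambaraIdeal T) : TambaraIdeal T :=
  span fun H => ((I.level H * J.level H : Ideal (T.obj H)) : Set (T.obj H))

/-- The `n`-fold product of `I` (the whole of `T` for `n = 0`). -/
def pow (I : TambaraIdeal T) : ℕ → TambaraIdeal T
  | 0 => ⊤
  | n + 1 => (pow I n).mul I

/-- `P` is proper if `1 ∉ P(G/G)`. -/
def IsProper (I : TambaraIdeal T) : Prop := (1 : T.obj ⊤) ∉ I.level ⊤

/-- (Nakaoka) prime ideals. -/
def IsPrime (P : TambaraIdeal T) : Prop :=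
  P.IsProper ∧ ∀ I J : TambaraIdeal T, I.mul J ≤ P → I ≤ P ∨ J ≤ P

theorem subset_span (X : ∀ H, Set (T.obj H)) (H : Subgroup G) : X H ⊆ (span X).level H :=
  fun _ hx => mem_sInf.2 fun _ hI => hI H hx

theorem span_le {X : ∀ H, Set (T.obj H)} {I : TambaraIdeal T} :
    span X ≤ I ↔ ∀ H, X H ⊆ I.level H :=
  ⟨fun h H _ hx => h H (subset_span X H hx), fun h => sInf_le h⟩

theorem mem_principal {H : Subgroup G} (x : T.obj H) : x ∈ (principal x).level H :=
  mem_sInf.2 fun _ hI => hI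

theorem principal_le {H : Subgroup G} {x : T.obj H} {I : TambaraIdeal T} :
    principal x ≤ I ↔ x ∈ I.level H :=
  ⟨fun h => h H (mem_principal x), fun h => sInf_le h⟩

theorem mul_le {I J K : TambaraIdeal T} :
    I.mul J ≤ K ↔ ∀ H, ∀ x ∈ I.level H, ∀ y ∈ J.level H, x * y ∈ K.level H := by
  rw [mul, span_le]
  exact forall_congr' fun H => Ideal.mul_le (I := I.level H) (J := J.level H) (K := K.level H)

theorem mul_mem_mul {I J : TambaraIdeal T} {H : Subgroup G} {x y : T.obj H}
    (hx : x ∈ I.level H) (hy : y ∈ J.level H) : x * y ∈ (I.mul J).level H :=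
  mul_le.1 le_rfl H x hx y hy

theorem mul_mono {I I' J J' : TambaraIdeal T} (h : I ≤ I') (h' : J ≤ J') :
    I.mul J ≤ I'.mul J' :=
  mul_le.2 fun H _ hx _ hy => mul_mem_mul (h H hx) (h' H hy)

theorem mul_le_left (I J : TambaraIdeal T) : I.mul J ≤ I :=
  mul_le.2 fun H _ hx y _ => (I.level H).mul_mem_right y hx

theorem mul_le_right (I J : TambaraIdeal T) : I.mul J ≤ J :=
  mul_le.2 fun H x _ _ hy => (J.level H).mul_mem_left x hy

theorem pow_mono {I J : TambaraIdeal T} (h : I ≤ J) (n : ℕ) : I.pow n ≤ J.pow n := by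
  induction n with
  | zero => exact le_rfl
  | succ n ih => exact mul_mono ih h

theorem mem_top {H : Subgroup G} (x : T.obj H) : x ∈ (⊤ : TambaraIdeal T).level H := by
  have : (⊤ : TambaraIdeal T) = sInf ∅ := sInf_empty.symm
  rw [this, mem_sInf]
  simp

theorem pow_one (I : TambaraIdeal T) : I.pow 1 = I := by
  apply le_antisymm (mul_le_right _ _)
  intro H x hx
  have := mul_mem_mul (I := ⊤) (J := I) (mem_top (1 : T.obj H)) hx
  rwa [one_mul] at this

theorem pow_succ_le (I : TambaraIdeal T) (n : ℕ) : I.pow (n + 1) ≤ I.pow n := mul_le_left _ _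

theorem pow_anti (I : TambaraIdeal T) {m n : ℕ} (h : m ≤ n) : I.pow n ≤ I.pow m :=
  antitone_nat_of_succ_le I.pow_succ_le h

/-- If all `a i` lie in `I` or `J`, then the norm of their sum lies in `I + J`. -/
theorem norm_add_mem (I J : TambaraIdeal T) {H L : Subgroup G} (h : H ≤ L) {a b : T.obj H}
    (ha : a ∈ I.level H) (hb : b ∈ J.level H) :
    T.norm h (a + b) ∈ I.level L ⊔ J.level L := by
  have e := T.norm_sum h 2 ![a, b]
  rw [Fin.sum_univ_two] at e
  simp only [Matrix.cons_val_zero, Matrix.cons_val_one] at e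
  rw [e]
  apply Ideal.sum_mem
  intro f _
  have key : ∀ (M : TambaraIdeal T) (γ : DCosets (stab L f.out) H L),
      (![a, b] : Fin 2 → T.obj H) (f.out (QuotientGroup.mk γ.out)) ∈ M.level H →
      T.tr (stab_le L f.out) (∏ γ : DCosets (stab L f.out) H L,
        T.norm (inf_le_left : stab L f.out ⊓ cj (γ.out : G) H ≤ stab L f.out)
          (T.res (inf_le_right : stab L f.out ⊓ cj (γ.out : G) H ≤ cj (γ.out : G) H)
            (T.conj (γ.out : G) rfl
              ((![a, b] : Fin 2 → T.obj H) (f.out (QuotientGroup.mk γ.out)))))) ∈ M.level L := by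
    intro M γ hγ
    exact M.tr_mem _ (Ideal.prod_mem _ (Finset.mem_univ γ)
      (M.norm_mem _ (M.res_mem _ (M.conj_mem _ rfl hγ))))
  let γ₀ : DCosets (stab L f.out) H L := DoubleCoset.mk _ _ 1
  have h2 : ∀ i : Fin 2, ((![a, b] : Fin 2 → T.obj H) i ∈ I.level H) ∨
      ((![a, b] : Fin 2 → T.obj H) i ∈ J.level H) := by
    intro i
    fin_cases i
    · exact Or.inl ha
    · exact Or.inr hb
  rcases h2 (f.out (QuotientGroup.mk γ₀.out)) with h3 | h3
  · exact Ideal.mem_sup_left (key I γ₀ h3)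
  · exact Ideal.mem_sup_right (key J γ₀ h3)

/-- The norm is well defined modulo a Tambara ideal. -/
theorem norm_add_sub_mem (I : TambaraIdeal T) {H L : Subgroup G} (h : H ≤ L) (a : T.obj H)
    {b : T.obj H} (hb : b ∈ I.level H) : T.norm h (a + b) - T.norm h a ∈ I.level L := by
  have e := T.norm_sum h 2 ![a, b]
  have e' := T.norm_sum h 2 ![a, 0]
  rw [Fin.sum_univ_two] at e e'
  simp only [Matrix.cons_val_zero, Matrix.cons_val_one, add_zero] at e e'
  rw [e, e', ← Finset.sum_sub_distrib]
  apply Ideal.sum_mem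
  intro f _
  by_cases hf : ∃ γ : DCosets (stab L f.out) H L, f.out (QuotientGroup.mk γ.out) = 1
  · obtain ⟨γ, hγ⟩ := hf
    have key : ∀ c ∈ I.level H, T.tr (stab_le L f.out) (∏ γ : DCosets (stab L f.out) H L,
        T.norm (inf_le_left : stab L f.out ⊓ cj (γ.out : G) H ≤ stab L f.out)
          (T.res (inf_le_right : stab L f.out ⊓ cj (γ.out : G) H ≤ cj (γ.out : G) H)
            (T.conj (γ.out : G) rfl
              ((![a, c] : Fin 2 → T.obj H) (f.out (QuotientGroup.mk γ.out)))))) ∈ I.level L := by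
      intro c hc
      refine I.tr_mem _ (Ideal.prod_mem _ (Finset.mem_univ γ)
        (I.norm_mem _ (I.res_mem _ (I.conj_mem _ rfl ?_))))
      rw [hγ]
      exact hc
    exact Ideal.sub_mem _ (key b hb) (key 0 (Ideal.zero_mem _))
  · push Not at hf
    have h0 : ∀ i : Fin 2, i ≠ 1 → i = 0 := by decide
    have h1 : ∀ γ : DCosets (stab L f.out) H L,
        (![a, b] : Fin 2 → T.obj H) (f.out (QuotientGroup.mk γ.out)) =
        (![a, 0] : Fin 2 → T.obj H) (f.out (QuotientGroup.mk γ.out)) := by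
      intro γ
      rw [h0 _ (hf γ)]
      rfl
    simp only [h1, sub_self]
    exact Ideal.zero_mem _

/-- The levelwise sum of two Tambara ideals. -/
def add (I J : TambaraIdeal T) : TambaraIdeal T where
  level H := I.level H ⊔ J.level H
  res_mem h x hx := by
    obtain ⟨a, ha, b, hb, rfl⟩ := Submodule.mem_sup.1 hx
    rw [map_add]
    exact Submodule.add_mem_sup (I.res_mem h ha) (J.res_mem h hb)
  tr_mem h x hx := by
    obtain ⟨a, ha, b, hb, rfl⟩ := Submodule.mem_sup.1 hx
    rw [map_add]
    exact Submodule.add_mem_sup (I.tr_mem h ha) (J.tr_mem h hb)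
  norm_mem h x hx := by
    obtain ⟨a, ha, b, hb, rfl⟩ := Submodule.mem_sup.1 hx
    exact norm_add_mem I J h ha hb
  map_conj := image_conj_of_mem _ (fun g H K e x hx => by
    obtain ⟨a, ha, b, hb, rfl⟩ := Submodule.mem_sup.1 hx
    rw [map_add]
    exact Submodule.add_mem_sup (I.conj_mem g e ha) (J.conj_mem g e hb))

theorem add_mul_le (I J K : TambaraIdeal T) {M : TambaraIdeal T} (h : I.mul K ≤ M)
    (h' : J.mul K ≤ M) : (I.add J).mul K ≤ M := by
  refine mul_le.2 fun H x hx y hy => ?_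
  obtain ⟨a, ha, b, hb, rfl⟩ := Submodule.mem_sup.1 hx
  rw [add_mul]
  exact Ideal.add_mem _ (h H (mul_mem_mul ha hy)) (h' H (mul_mem_mul hb hy))

theorem mul_comm' (I J : TambaraIdeal T) : I.mul J = J.mul I := by
  apply le_antisymm <;>
    exact mul_le.2 fun H x hx y hy => by rw [mul_comm x y]; exact mul_mem_mul hy hx

theorem add_pow_le {I J M : TambaraIdeal T} {m n : ℕ} (hm : I.pow m ≤ M) (hn : J.pow n ≤ M)
    (k : ℕ) {A : TambaraIdeal T} (i j : ℕ) (hi : A ≤ I.pow i) (hj : A ≤ J.pow j)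
    (hk : m + n ≤ i + j + k) :
    (Nat.rec A (fun _ C => C.mul (I.add J)) k : TambaraIdeal T) ≤ M := by
  induction k generalizing A i j with
  | zero =>
    change A ≤ M
    rcases Nat.lt_or_ge i m with h | h
    · exact hj.trans ((pow_anti J (by omega)).trans hn)
    · exact hi.trans ((pow_anti I h).trans hm)
  | succ k ih =>
    have swap : ∀ (k : ℕ) (A : TambaraIdeal T),
        (Nat.rec A (fun _ C => C.mul (I.add J)) (k + 1) : TambaraIdeal T) =
          Nat.rec (A.mul (I.add J)) (fun _ C => C.mul (I.add J)) k := by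
      intro k
      induction k with
      | zero => intro A; rfl
      | succ k ih' =>
        intro A
        change TambaraIdeal.mul (Nat.rec A (fun _ C => C.mul (I.add J)) (k + 1)) (I.add J) = _
        rw [ih' A]
    rw [swap]
    have split : ∀ (k : ℕ) (A A₁ A₂ : TambaraIdeal T), A ≤ A₁.add A₂ →
        (Nat.rec A (fun _ C => C.mul (I.add J)) k : TambaraIdeal T) ≤
          TambaraIdeal.add (Nat.rec A₁ (fun _ C => C.mul (I.add J)) k)
            (Nat.rec A₂ (fun _ C => C.mul (I.add J)) k) := by
      intro k
      induction k with
      | zero => intro A A₁ A₂ h; exact h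
      | succ k ih' =>
        intro A A₁ A₂ h
        refine (mul_mono (ih' A A₁ A₂ h) le_rfl).trans ?_
        exact add_mul_le _ _ _ (fun H x hx => Ideal.mem_sup_left hx)
          (fun H x hx => Ideal.mem_sup_right hx)
    have h0 : A.mul (I.add J) ≤ (A.mul I).add (A.mul J) := by
      rw [mul_comm' A (I.add J)]
      refine add_mul_le _ _ _ ?_ ?_
      · rw [mul_comm' I A]; exact fun H x hx => Ideal.mem_sup_left hx
      · rw [mul_comm' J A]; exact fun H x hx => Ideal.mem_sup_right hx
    refine (split k _ _ _ h0).trans ?_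
    have hA := ih (A := A.mul I) (i + 1) j (mul_mono hi le_rfl) ((mul_le_left _ _).trans hj)
      (by omega)
    have hB := ih (A := A.mul J) i (j + 1) ((mul_le_left _ _).trans hi) (mul_mono hj le_rfl)
      (by omega)
    intro H x hx
    exact (sup_le (hA H) (hB H)) hx

theorem pow_add_le {I J M : TambaraIdeal T} {m n : ℕ} (hm : I.pow m ≤ M) (hn : J.pow n ≤ M) :
    (I.add J).pow (m + n) ≤ M := by
  have key : ∀ k : ℕ, (I.add J).pow k = Nat.rec ⊤ (fun _ C => C.mul (I.add J)) k := by
    intro k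
    induction k with
    | zero => rfl
    | succ k ih => rw [pow, ih]
  rw [key]
  exact add_pow_le (A := ⊤) hm hn (m + n) 0 0 le_rfl le_rfl (by omega)

/-- The radical `√I`: all `x` with `⟨x⟩ⁿ ⊆ I` for some `n ≥ 1`. -/
def radical (I : TambaraIdeal T) : TambaraIdeal T where
  level H :=
    { carrier := {x | ∃ n : ℕ, 1 ≤ n ∧ (principal x).pow n ≤ I}
      zero_mem' := ⟨1, le_rfl, by
        rw [pow_one, principal_le]; exact Ideal.zero_mem _⟩
      add_mem' := by
        rintro x y ⟨m, hm, hx⟩ ⟨n, hn, hy⟩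
        refine ⟨m + n, by omega, (pow_mono ?_ _).trans (pow_add_le hx hy)⟩
        exact principal_le.2 (Submodule.add_mem_sup (mem_principal x) (mem_principal y))
      smul_mem' := by
        rintro c x ⟨n, hn, hx⟩
        exact ⟨n, hn, (pow_mono (principal_le.2
          (Ideal.mul_mem_left _ c (mem_principal x))) n).trans hx⟩ }
  res_mem h x := by
    rintro ⟨n, hn, hx⟩
    exact ⟨n, hn, (pow_mono (principal_le.2 (res_mem _ h (mem_principal x))) n).trans hx⟩
  tr_mem h x := by
    rintro ⟨n, hn, hx⟩
    exact ⟨n, hn, (pow_mono (principal_le.2 (tr_mem _ h (mem_principal x))) n).trans hx⟩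
  norm_mem h x := by
    rintro ⟨n, hn, hx⟩
    exact ⟨n, hn, (pow_mono (principal_le.2 (norm_mem _ h (mem_principal x))) n).trans hx⟩
  map_conj := image_conj_of_mem _ (by
    rintro g H K e x ⟨n, hn, hx⟩
    exact ⟨n, hn, (pow_mono (principal_le.2 (conj_mem _ g e (mem_principal x))) n).trans hx⟩)

theorem mem_radical {I : TambaraIdeal T} {H : Subgroup G} {x : T.obj H} :
    x ∈ I.radical.level H ↔ ∃ n : ℕ, 1 ≤ n ∧ (principal x).pow n ≤ I := Iff.rfl

/-- Radical Tambara ideals. -/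
def IsRadical (I : TambaraIdeal T) : Prop := I = I.radical

theorem le_radical (I : TambaraIdeal T) : I ≤ I.radical := fun _ x hx =>
  ⟨1, le_rfl, by rw [pow_one]; exact principal_le.2 hx⟩

theorem isRadical_iff {I : TambaraIdeal T} : I.IsRadical ↔
    ∀ (H : Subgroup G) (x : T.obj H) (n : ℕ), (principal x).pow n ≤ I → x ∈ I.level H := by
  constructor
  · intro h H x n hx
    rw [IsRadical] at h
    rw [h]
    exact ⟨n + 1, by omega, (pow_succ_le _ n).trans hx⟩
  · intro h
    exact le_antisymm I.le_radical (fun H x ⟨n, _, hx⟩ => h H x n hx)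

/-- The zero ideal. -/
def zero (T : TambaraFunctor.{u} G) : TambaraIdeal T where
  level _ := ⊥
  res_mem h x hx := by
    rw [Ideal.mem_bot] at hx ⊢; rw [hx, map_zero]
  tr_mem h x hx := by
    rw [Ideal.mem_bot] at hx ⊢; rw [hx, map_zero]
  norm_mem h x hx := by
    rw [Ideal.mem_bot] at hx ⊢; rw [hx, T.norm_zero]
  map_conj := image_conj_of_mem _ (fun g H K e x hx => by
    rw [SetLike.mem_coe, Ideal.mem_bot] at hx ⊢; rw [hx, map_zero])

end TambaraIdeal

/-- The nilradical `𝔑(T) = √0`. -/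
def nilradical (T : TambaraFunctor.{u} G) : TambaraIdeal T := (TambaraIdeal.zero T).radical

end Basics

section Functoriality

variable {T : TambaraFunctor.{u} G} {S : TambaraFunctor.{w} G}

/-- The levelwise preimage `φ⁻¹(J)` of a Tambara ideal. -/
def TambaraIdeal.comap (φ : TambaraHom T S) (J : TambaraIdeal S) : TambaraIdeal T where
  level H := (J.level H).comap (φ.app H)
  res_mem h x hx := by
    rw [Ideal.mem_comap] at hx ⊢; rw [φ.app_res]; exact J.res_mem h hx
  tr_mem h x hx := by
    rw [Ideal.mem_comap] at hx ⊢; rw [φ.app_tr]; exact J.tr_mem h hx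
  norm_mem h x hx := by
    rw [Ideal.mem_comap] at hx ⊢; rw [φ.app_norm]; exact J.norm_mem h hx
  map_conj := image_conj_of_mem _ (fun g H K e x hx => by
    rw [SetLike.mem_coe, Ideal.mem_comap] at hx ⊢; rw [φ.app_conj]; exact J.conj_mem g e hx)

/-- The extension `φ_*(I)`: the Tambara ideal generated by the images `φ_H(I(G/H))`. -/
def TambaraIdeal.extend (φ : TambaraHom T S) (I : TambaraIdeal T) : TambaraIdeal S :=
  TambaraIdeal.span fun H => φ.app H '' (I.level H : Set (T.obj H))

end Functoriality

section Quotient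

variable (T : TambaraFunctor.{u} G) (I : TambaraIdeal T)

/-- The levelwise quotient ring `T(G/H) / I(G/H)`. -/
abbrev QuotObj (H : Subgroup G) : Type u := T.obj H ⧸ I.level H

variable {T}

/-- The norm on the quotient. -/
def quotNorm {K H : Subgroup G} (h : K ≤ H) : QuotObj T I K →* QuotObj T I H where
  toFun := Quotient.lift (fun x => Ideal.Quotient.mk (I.level H) (T.norm h x)) (by
    intro x y hxy
    have hxy' : Ideal.Quotient.mk (I.level K) x = Ideal.Quotient.mk (I.level K) y :=
      Quotient.sound hxy
    rw [Ideal.Quotient.eq] at hxy'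
    change Ideal.Quotient.mk (I.level H) _ = Ideal.Quotient.mk (I.level H) _
    rw [Ideal.Quotient.eq]
    have := I.norm_add_sub_mem h y hxy'
    rwa [add_sub_cancel] at this)
  map_one' := by
    change Ideal.Quotient.mk (I.level H) (T.norm h 1) = 1
    rw [map_one, map_one]
  map_mul' x y := by
    obtain ⟨x, rfl⟩ := Ideal.Quotient.mk_surjective x
    obtain ⟨y, rfl⟩ := Ideal.Quotient.mk_surjective y
    rw [← map_mul]
    change Ideal.Quotient.mk (I.level H) (T.norm h (x * y)) =
      Ideal.Quotient.mk (I.level H) (T.norm h x) * Ideal.Quotient.mk (I.level H) (T.norm h y)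
    rw [map_mul, map_mul]

/-- The transfer on the quotient. -/
def quotTr {K H : Subgroup G} (h : K ≤ H) : QuotObj T I K →+ QuotObj T I H where
  toFun := Quotient.lift (fun x => Ideal.Quotient.mk (I.level H) (T.tr h x)) (by
    intro x y hxy
    have hxy' : Ideal.Quotient.mk (I.level K) x = Ideal.Quotient.mk (I.level K) y :=
      Quotient.sound hxy
    rw [Ideal.Quotient.eq] at hxy'
    change Ideal.Quotient.mk (I.level H) _ = Ideal.Quotient.mk (I.level H) _
    rw [Ideal.Quotient.eq, ← map_sub]
    exact I.tr_mem h hxy')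
  map_zero' := by
    change Ideal.Quotient.mk (I.level H) (T.tr h 0) = 0
    rw [map_zero, map_zero]
  map_add' x y := by
    obtain ⟨x, rfl⟩ := Ideal.Quotient.mk_surjective x
    obtain ⟨y, rfl⟩ := Ideal.Quotient.mk_surjective y
    rw [← map_add]
    change Ideal.Quotient.mk (I.level H) (T.tr h (x + y)) =
      Ideal.Quotient.mk (I.level H) (T.tr h x) + Ideal.Quotient.mk (I.level H) (T.tr h y)
    rw [map_add, map_add]

/-- The restriction on the quotient. -/
def quotRes {K H : Subgroup G} (h : K ≤ H) : QuotObj T I H →+* QuotObj T I K :=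
  Ideal.quotientMap (I.level K) (T.res h) (fun _ hx => I.res_mem h hx)

/-- The conjugation on the quotient. -/
def quotConj (g : G) {H K : Subgroup G} (e : K = cj g H) : QuotObj T I H ≃+* QuotObj T I K :=
  Ideal.quotientEquiv (I.level H) (I.level K) (T.conj g e) (by
    apply SetLike.coe_injective
    rw [← I.map_conj g e]
    ext y
    constructor
    · rintro ⟨x, hx, rfl⟩
      exact Ideal.mem_map_of_mem _ hx
    · intro hy
      exact (Ideal.mem_map_iff_of_surjective (T.conj g e : T.obj H →+* T.obj K)
        (T.conj g e).surjective).1 hy)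

theorem quotNorm_mk {K H : Subgroup G} (h : K ≤ H) (x : T.obj K) :
    quotNorm I h (Ideal.Quotient.mk _ x) = Ideal.Quotient.mk _ (T.norm h x) := rfl

theorem quotTr_mk {K H : Subgroup G} (h : K ≤ H) (x : T.obj K) :
    quotTr I h (Ideal.Quotient.mk _ x) = Ideal.Quotient.mk _ (T.tr h x) := rfl

theorem quotRes_mk {K H : Subgroup G} (h : K ≤ H) (x : T.obj H) :
    quotRes I h (Ideal.Quotient.mk _ x) = Ideal.Quotient.mk _ (T.res h x) := rfl

theorem quotConj_mk (g : G) {H K : Subgroup G} (e : K = cj g H) (x : T.obj H) :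
    quotConj I g e (Ideal.Quotient.mk _ x) = Ideal.Quotient.mk _ (T.conj g e x) := rfl

variable (T)

/-- The quotient Tambara functor `T / I`, with levels `T(G/H) / I(G/H)`. -/
def TambaraFunctor.quot : TambaraFunctor.{u} G where
  obj := QuotObj T I
  res := quotRes I
  tr := quotTr I
  norm := quotNorm I
  conj := quotConj I
  res_refl x := by
    obtain ⟨x, rfl⟩ := Ideal.Quotient.mk_surjective x
    rw [quotRes_mk, T.res_refl]
  res_trans h h' x := by
    obtain ⟨x, rfl⟩ := Ideal.Quotient.mk_surjective x
    simp only [quotRes_mk, T.res_trans]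
  tr_refl x := by
    obtain ⟨x, rfl⟩ := Ideal.Quotient.mk_surjective x
    rw [quotTr_mk, T.tr_refl]
  tr_trans h h' x := by
    obtain ⟨x, rfl⟩ := Ideal.Quotient.mk_surjective x
    simp only [quotTr_mk, T.tr_trans]
  norm_refl x := by
    obtain ⟨x, rfl⟩ := Ideal.Quotient.mk_surjective x
    rw [quotNorm_mk, T.norm_refl]
  norm_trans h h' x := by
    obtain ⟨x, rfl⟩ := Ideal.Quotient.mk_surjective x
    simp only [quotNorm_mk, T.norm_trans]
  conj_mul g h H K L hK hL hL' x := by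
    obtain ⟨x, rfl⟩ := Ideal.Quotient.mk_surjective x
    simp only [quotConj_mk, T.conj_mul g h hK hL hL']
  conj_of_mem hh e x := by
    obtain ⟨x, rfl⟩ := Ideal.Quotient.mk_surjective x
    rw [quotConj_mk, T.conj_of_mem hh]
  conj_res g _ _ _ _ h h' hK hH x := by
    obtain ⟨x, rfl⟩ := Ideal.Quotient.mk_surjective x
    simp only [quotConj_mk, quotRes_mk, T.conj_res g h h' hK hH]
  conj_norm g _ _ _ _ h h' hK hH x := by
    obtain ⟨x, rfl⟩ := Ideal.Quotient.mk_surjective x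
    simp only [quotConj_mk, quotNorm_mk, T.conj_norm g h h' hK hH]
  conj_tr g _ _ _ _ h h' hK hH x := by
    obtain ⟨x, rfl⟩ := Ideal.Quotient.mk_surjective x
    simp only [quotConj_mk, quotTr_mk, T.conj_tr g h h' hK hH]
  res_tr hH hL x := by
    obtain ⟨x, rfl⟩ := Ideal.Quotient.mk_surjective x
    simp only [quotConj_mk, quotTr_mk, quotRes_mk, T.res_tr, map_sum]
  res_norm hH hL x := by
    obtain ⟨x, rfl⟩ := Ideal.Quotient.mk_surjective x
    simp only [quotConj_mk, quotNorm_mk, quotRes_mk, T.res_norm, map_prod]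
  frobenius h x y := by
    obtain ⟨x, rfl⟩ := Ideal.Quotient.mk_surjective x
    obtain ⟨y, rfl⟩ := Ideal.Quotient.mk_surjective y
    rw [quotRes_mk, ← map_mul, quotTr_mk, T.frobenius, quotTr_mk, map_mul]
  norm_sum h n a := by
    choose b hb using fun i => Ideal.Quotient.mk_surjective (a i)
    obtain rfl : (fun i => Ideal.Quotient.mk _ (b i)) = a := funext hb
    rw [← map_sum, quotNorm_mk, T.norm_sum, map_sum]
    simp only [quotConj_mk, quotRes_mk, quotNorm_mk, ← map_prod, quotTr_mk]
  norm_tr hKH hHL x := by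
    obtain ⟨x, rfl⟩ := Ideal.Quotient.mk_surjective x
    rw [quotTr_mk, quotNorm_mk, T.norm_tr, map_sum]
    simp only [quotConj_mk, quotRes_mk, quotNorm_mk, ← map_prod, quotTr_mk]

/-- The projection `π : T → T / I`. -/
def TambaraFunctor.proj : TambaraHom T (T.quot I) where
  app H := Ideal.Quotient.mk (I.level H)
  app_res _ _ := rfl
  app_tr _ _ := rfl
  app_norm _ _ := rfl
  app_conj _ _ _ _ _ := rfl

/-- The reduction `T_red = T / 𝔑(T)`. -/
def TambaraFunctor.red : TambaraFunctor.{u} G := T.quot (nilradical T)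

/-- The projection `T → T_red`. -/
def TambaraFunctor.projRed : TambaraHom T T.red := T.proj (nilradical T)

end Quotient

section Frames

variable (T : TambaraFunctor.{u} G)

/-- `RadId_G(T)`: the radical Tambara ideals, ordered by inclusion. -/
def RadId : Type (max u v) := {I : TambaraIdeal T // I.IsRadical}

instance : PartialOrder (RadId T) := inferInstanceAs (PartialOrder {I : TambaraIdeal T // _})

variable {T}

open TambaraIdeal

instance : InfSet (RadId T) where
  sInf A := ⟨sInf (Subtype.val '' A), by
    rw [isRadical_iff]
    intro H x n hx
    rw [mem_sInf]
    rintro _ ⟨J, hJ, rfl⟩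
    exact isRadical_iff.1 J.2 H x n (hx.trans (sInf_le ⟨J, hJ, rfl⟩))⟩

instance : CompleteLattice (RadId T) :=
  completeLatticeOfInf _ (fun _ => ⟨fun J hJ => sInf_le (a := J.1) ⟨J, hJ, rfl⟩, fun K hK =>
    le_sInf (a := K.1) (by rintro _ ⟨J, hJ, rfl⟩; exact hK hJ)⟩)

theorem mem_inf_radId {I J : RadId T} {H : Subgroup G} {x : T.obj H} :
    x ∈ (I ⊓ J).1.level H ↔ x ∈ I.1.level H ∧ x ∈ J.1.level H := by
  constructor
  · intro hx
    exact ⟨(inf_le_left : I ⊓ J ≤ I) H hx, (inf_le_right : I ⊓ J ≤ J) H hx⟩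
  · rintro ⟨h1, h2⟩
    change x ∈ (sInf (Subtype.val '' ({I, J} : Set (RadId T)))).level H
    rw [mem_sInf]
    rintro _ ⟨K, (rfl | rfl), rfl⟩
    · exact h1
    · exact h2

/-- The radical ideal of all `x` with `⟨x⟩ K ⊆ R`. -/
def himpRadId (K R : RadId T) : RadId T :=
  ⟨{ level := fun H =>
      { carrier := {x | (principal x).mul K.1 ≤ R.1}
        zero_mem' := (mul_le_left _ _).trans (principal_le.2 (Ideal.zero_mem _))
        add_mem' := by
          intro x y hx hy
          exact (mul_mono (principal_le.2
            (Submodule.add_mem_sup (mem_principal x) (mem_principal y)) :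
              principal (x + y) ≤ (principal x).add (principal y)) le_rfl).trans
            (add_mul_le _ _ _ hx hy)
        smul_mem' := by
          intro c x hx
          exact (mul_mono (principal_le.2
            (Ideal.mul_mem_left _ c (mem_principal x))) le_rfl).trans hx }
     res_mem := fun h x hx =>
       (mul_mono (principal_le.2 (res_mem _ h (mem_principal x))) le_rfl).trans hx
     tr_mem := fun h x hx =>
       (mul_mono (principal_le.2 (tr_mem _ h (mem_principal x))) le_rfl).trans hx
     norm_mem := fun h x hx =>
       (mul_mono (principal_le.2 (norm_mem _ h (mem_principal x))) le_rfl).trans hx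
     map_conj := image_conj_of_mem _ (fun g H K e x hx =>
       (mul_mono (principal_le.2 (conj_mem _ g e (mem_principal x))) le_rfl).trans hx) }, by
    rw [isRadical_iff]
    intro H x n hx
    refine mul_le.2 fun L y hy k hk => ?_
    have hz1 : y * k ∈ (principal x).level L := Ideal.mul_mem_right _ _ hy
    have hz2 : y * k ∈ K.1.level L := Ideal.mul_mem_left _ _ hk
    refine isRadical_iff.1 R.2 L (y * k) (n + 1) ?_
    refine (mul_mono ((pow_mono (principal_le.2 hz1) n).trans hx) (principal_le.2 hz2)).trans ?_
    exact mul_le.2 fun M a ha b hb =>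
      (show (principal a).mul K.1 ≤ R.1 from ha) M (mul_mem_mul (mem_principal a) hb)⟩

theorem le_himpRadId_iff {A K R : RadId T} : A ≤ himpRadId K R ↔ K ⊓ A ≤ R := by
  constructor
  · intro h H x hx
    obtain ⟨hK, hA⟩ := mem_inf_radId.1 hx
    have h1 : (principal x).mul K.1 ≤ R.1 := h H hA
    refine isRadical_iff.1 R.2 H x 2 ((mul_mono ?_ (principal_le.2 hK)).trans h1)
    exact (TambaraIdeal.pow_one _).le
  · intro h H x hx
    change (principal x).mul K.1 ≤ R.1
    refine mul_le.2 fun L y hy k hk => h L (mem_inf_radId.2 ⟨Ideal.mul_mem_left _ _ hk, ?_⟩)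
    exact Ideal.mul_mem_right _ _ ((principal_le.2 hx : principal x ≤ A.1) L hy)

/-- `RadId_G(T)` is a frame; meets are levelwise intersections. -/
instance : Order.Frame (RadId T) :=
  Order.Frame.ofMinimalAxioms
    { inf_sSup_le_iSup_inf := fun K A => le_himpRadId_iff.1 (sSup_le fun J hJ =>
        le_himpRadId_iff.2 (le_iSup₂_of_le J hJ le_rfl)) }

/-- `↑√I`: the radical Tambara ideals containing `√I`. -/
def UpRad (I : TambaraIdeal T) : Type (max u v) := {J : RadId T // I.radical ≤ J.1}

variable {I : TambaraIdeal T}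

instance : PartialOrder (UpRad I) := inferInstanceAs (PartialOrder {J : RadId T // _})

instance : InfSet (UpRad I) where
  sInf A := ⟨sInf (Subtype.val '' A), by
    refine le_sInf ?_
    rintro _ ⟨_, ⟨J, _, rfl⟩, rfl⟩
    exact J.2⟩

instance : CompleteLattice (UpRad I) :=
  completeLatticeOfInf _ (fun _ => ⟨fun J hJ => sInf_le (a := J.1) ⟨J, hJ, rfl⟩, fun K hK =>
    le_sInf (a := K.1) (by rintro _ ⟨J, hJ, rfl⟩; exact hK hJ)⟩)

theorem inf_upRad (J K : UpRad I) : (J ⊓ K).1 = J.1 ⊓ K.1 := by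
  apply le_antisymm
  · exact le_inf (inf_le_left : J ⊓ K ≤ J) (inf_le_right : J ⊓ K ≤ K)
  · have h : I.radical ≤ (J.1 ⊓ K.1).1 := fun H x hx => mem_inf_radId.2 ⟨J.2 H hx, K.2 H hx⟩
    let M : UpRad I := ⟨J.1 ⊓ K.1, h⟩
    exact (le_inf (inf_le_left : J.1 ⊓ K.1 ≤ J.1) (inf_le_right : J.1 ⊓ K.1 ≤ K.1) :
      M ≤ J ⊓ K)

/-- `↑√I` is a frame. -/
instance : Order.Frame (UpRad I) :=
  Order.Frame.ofMinimalAxioms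
    { inf_sSup_le_iSup_inf := fun K A => by
        set R : UpRad I := ⨆ b ∈ A, K ⊓ b
        have hR : R.1 ≤ K.1 ⇨ R.1 := le_himp
        let M : UpRad I := ⟨K.1 ⇨ R.1, R.2.trans hR⟩
        have h1 : sSup A ≤ M := sSup_le fun J hJ => by
          have h2 : K ⊓ J ≤ R := le_iSup₂_of_le J hJ le_rfl
          have h3 : K.1 ⊓ J.1 ≤ R.1 := by rw [← inf_upRad]; exact h2
          exact (le_himp_iff'.2 h3 : J.1 ≤ K.1 ⇨ R.1)
        have h4 : K.1 ⊓ (sSup A).1 ≤ R.1 := le_himp_iff'.1 h1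
        rw [← inf_upRad] at h4
        exact h4 }

end Frames

/-- An isomorphism in the category of frames: a pair of mutually inverse frame homomorphisms. -/
structure FrameIso (A : Type*) (B : Type*) [Order.Frame A] [Order.Frame B] where
  hom : FrameHom A B
  inv : FrameHom B A
  inv_hom : ∀ a, inv (hom a) = a
  hom_inv : ∀ b, hom (inv b) = b

section Spectrum

variable (T : TambaraFunctor.{u} G)

/-- The Nakaoka spectrum: the prime Tambara ideals. -/
def SpecNak : Type (max u v) := {P : TambaraIdeal T // P.IsPrime}

variable {T}

/-- The set `V_H(x)` of primes `P` with `x ∈ P(G/H)`. -/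
def VElt {H : Subgroup G} (x : T.obj H) : Set (SpecNak T) := {P | x ∈ P.1.level H}

/-- The Nakaoka topology: the sets `V_H(x)` form a subbasis of closed sets. -/
instance : TopologicalSpace (SpecNak T) :=
  TopologicalSpace.generateFrom {U | ∃ (H : Subgroup G) (x : T.obj H), U = (VElt x)ᶜ}

/-- `V(I)`: the primes containing `I`. -/
def VIdeal (I : TambaraIdeal T) : Set (SpecNak T) := {P | I ≤ P.1}

end Spectrum

end Tambara

open Tambara

namespace Tambara

variable {G : Type v} [Group G] [Finite G]

namespace TambaraIdeal

/-! ### Extension and contraction of Tambara ideals along a levelwise surjective morphism. -/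

section Surjective

variable {T : TambaraFunctor.{u} G} {S : TambaraFunctor.{w} G} {φ : TambaraHom T S}

/-! This is the correspondence theorem for quotients, and it holds for any levelwise surjective `φ :
T → S`. Extension is left adjoint to contraction (`extend_le_iff`). By surjectivity the levelwise
image of a Tambara ideal is already a Tambara ideal, so extension is computed elementwise
(`mem_extend_iff`). Hence extending a contraction gives back the ideal, and contracting an extension
gives back every ideal that contains the kernel: `extend_comap`, `comap_extend`.

Both radicality and primality are conditions on products, and extension commutes with products and
powers (`extend_mul`, `extend_pow`). Combined with the adjunction, this lets both properties pass
through contraction in either direction: `isRadical_comap_iff`, `isPrime_comap_iff`. The order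
isomorphism on radical ideals and the bijection on primes follow. An order isomorphism of frames
preserves joins and finite meets, so it is a frame isomorphism.

The map on spectra is an embedding because the subbasic closed set of `x` pulls back to that of `φ
x`, and every subbasic closed set of the source arises so. Its image is the set of primes containing
the kernel, which is `I` when `φ` is the projection to `T / I`. Primes are radical, so they contain
`I` exactly when they contain `√I`; for `I = √0` this is no condition, which gives the statement
about `T_red`. -/

theorem extend_le_iff {A : TambaraIdeal T} {J : TambaraIdeal S} :
    A.extend φ ≤ J ↔ A ≤ J.comap φ := by
  rw [extend, span_le]
  exact forall_congr' fun _ => Set.image_subset_iff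

theorem app_mem_extend {A : TambaraIdeal T} {H : Subgroup G} {x : T.obj H}
    (hx : x ∈ A.level H) : φ.app H x ∈ (A.extend φ).level H :=
  subset_span _ H ⟨x, hx, rfl⟩

theorem le_comap_extend (A : TambaraIdeal T) : A ≤ (A.extend φ).comap φ :=
  fun _ _ hx => app_mem_extend hx

theorem extend_principal {H : Subgroup G} (x : T.obj H) :
    (principal x).extend φ = principal (φ.app H x) := by
  apply le_antisymm
  · exact extend_le_iff.2 (principal_le.2 (mem_principal (φ.app H x)))
  · exact principal_le.2 (app_mem_extend (mem_principal x))

theorem comap_mono {J K : TambaraIdeal S} (h : J ≤ K) : J.comap φ ≤ K.comap φ :=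
  fun H _ hx => h H hx

/-- The levelwise image of a Tambara ideal under a levelwise surjective morphism. -/
def image (φ : TambaraHom T S) (hφ : ∀ H, Function.Surjective (φ.app H)) (A : TambaraIdeal T) :
    TambaraIdeal S where
  level H := (A.level H).map (φ.app H)
  res_mem {K H} h x hx := by
    obtain ⟨a, ha, rfl⟩ := (Ideal.mem_map_iff_of_surjective _ (hφ H)).1 hx
    rw [← φ.app_res]
    exact Ideal.mem_map_of_mem _ (A.res_mem h ha)
  tr_mem {K H} h x hx := by
    obtain ⟨a, ha, rfl⟩ := (Ideal.mem_map_iff_of_surjective _ (hφ K)).1 hx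
    rw [← φ.app_tr]
    exact Ideal.mem_map_of_mem _ (A.tr_mem h ha)
  norm_mem {K H} h x hx := by
    obtain ⟨a, ha, rfl⟩ := (Ideal.mem_map_iff_of_surjective _ (hφ K)).1 hx
    rw [← φ.app_norm]
    exact Ideal.mem_map_of_mem _ (A.norm_mem h ha)
  map_conj := image_conj_of_mem _ (fun g H K e x hx => by
    obtain ⟨a, ha, rfl⟩ := (Ideal.mem_map_iff_of_surjective _ (hφ H)).1 hx
    rw [← φ.app_conj]
    exact Ideal.mem_map_of_mem _ (A.conj_mem g e ha))

variable (hφ : ∀ H, Function.Surjective (φ.app H))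
include hφ

/-- Elements of the quotient lift, so the levelwise image is closed under all operations and
generating an ideal from it adds nothing. This is where surjectivity enters the study of extension.
-/
theorem mem_extend_iff {A : TambaraIdeal T} {H : Subgroup G} {y : S.obj H} :
    y ∈ (A.extend φ).level H ↔ ∃ a ∈ A.level H, φ.app H a = y := by
  constructor
  · intro hy
    have h : A.extend φ ≤ image φ hφ A := extend_le_iff.2 fun H x hx => Ideal.mem_map_of_mem _ hx
    exact (Ideal.mem_map_iff_of_surjective _ (hφ H)).1 (h H hy)
  · rintro ⟨a, ha, rfl⟩
    exact app_mem_extend ha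

theorem extend_comap (J : TambaraIdeal S) : (J.comap φ).extend φ = J := by
  apply le_antisymm (extend_le_iff.2 le_rfl)
  intro H y hy
  obtain ⟨x, rfl⟩ := hφ H y
  exact (mem_extend_iff hφ).2 ⟨x, hy, rfl⟩

/-- The adjunction with invertible counit makes contraction an order embedding. -/
theorem comap_le_comap_iff {J K : TambaraIdeal S} : J.comap φ ≤ K.comap φ ↔ J ≤ K := by
  rw [← extend_le_iff, extend_comap hφ]

/-- Ideals containing the kernel are recovered from their extension. -/
theorem comap_extend {A : TambaraIdeal T} (hA : (zero S).comap φ ≤ A) :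
    (A.extend φ).comap φ = A := by
  apply le_antisymm _ (le_comap_extend A)
  intro H x hx
  obtain ⟨a, ha, hax⟩ := (mem_extend_iff hφ).1 hx
  -- `x` and `a` have the same image, so they differ by an element of the kernel, which lies in `A`.
  have h : x - a ∈ A.level H := hA H (by
    change φ.app H (x - a) = 0
    rw [map_sub, hax, sub_self])
  simpa using Ideal.add_mem _ h ha

/-- By the adjunction and the universal property of the product, each inclusion needs checking only
on products of two elements; for the second one, the factors are lifted to `A` and `B`. -/
theorem extend_mul (A B : TambaraIdeal T) :
    (A.mul B).extend φ = (A.extend φ).mul (B.extend φ) := by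
  apply le_antisymm
  · refine extend_le_iff.2 (mul_le.2 fun H x hx y hy => ?_)
    change φ.app H (x * y) ∈ ((A.extend φ).mul (B.extend φ)).level H
    rw [map_mul]
    exact mul_mem_mul (app_mem_extend hx) (app_mem_extend hy)
  · refine mul_le.2 fun H x hx y hy => ?_
    obtain ⟨a, ha, rfl⟩ := (mem_extend_iff hφ).1 hx
    obtain ⟨b, hb, rfl⟩ := (mem_extend_iff hφ).1 hy
    rw [← map_mul]
    exact app_mem_extend (mul_mem_mul ha hb)

theorem extend_pow (A : TambaraIdeal T) (n : ℕ) : (A.pow n).extend φ = (A.extend φ).pow n := by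
  induction n with
  | zero =>
    -- The zeroth power is `⊤`, whose extension is again `⊤` only because `φ` is surjective.
    refine le_antisymm le_top fun H y _ => ?_
    obtain ⟨x, rfl⟩ := hφ H y
    exact (mem_extend_iff hφ).2 ⟨x, mem_top x, rfl⟩
  | succ n ih => rw [pow, pow, extend_mul hφ, ih]

/-- The criterion `isRadical_iff` for `J.comap φ` at `x` is the one for `J` at `φ x`, and these
elements exhaust `S`. -/
theorem isRadical_comap_iff {J : TambaraIdeal S} : (J.comap φ).IsRadical ↔ J.IsRadical := by
  have h : ∀ (H : Subgroup G) (x : T.obj H) (n : ℕ),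
      (principal x).pow n ≤ J.comap φ ↔ (principal (φ.app H x)).pow n ≤ J := fun H x n => by
    rw [← extend_le_iff, extend_pow hφ, extend_principal]
  simp only [isRadical_iff, h]
  constructor
  · intro hJ H y n hy
    obtain ⟨x, rfl⟩ := hφ H y
    exact hJ H x n hy
  · exact fun hJ H x n hx => hJ H _ n hx

theorem isPrime_comap_iff {J : TambaraIdeal S} : (J.comap φ).IsPrime ↔ J.IsPrime := by
  refine and_congr ?_ ⟨fun h A B hAB => ?_, fun h A B hAB => ?_⟩
  · change ¬ φ.app ⊤ 1 ∈ J.level ⊤ ↔ _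
    rw [map_one]
    rfl
  -- Ideals of `S` are tested by contracting them: the product of the contractions of `A` and `B`
  -- extends to `A.mul B`.
  · rw [← comap_le_comap_iff hφ, ← comap_le_comap_iff (J := B) hφ]
    apply h
    rwa [← extend_le_iff, extend_mul hφ, extend_comap hφ, extend_comap hφ]
  -- Ideals of `T` are tested by extending them, using that extension is multiplicative.
  · rw [← extend_le_iff, ← extend_le_iff]
    apply h
    rwa [← extend_mul hφ, extend_le_iff]

end Surjective

/-! ### Primes, radicals and the nilradical. -/

variable {T : TambaraFunctor.{u} G}

/-- Primality strips one factor of `⟨x⟩` at a time. The induction ends at the zeroth power `⊤`,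
which a proper ideal cannot contain. -/
theorem IsPrime.isRadical {P : TambaraIdeal T} (hP : P.IsPrime) : P.IsRadical := by
  rw [isRadical_iff]
  intro H x n hx
  rw [← principal_le]
  induction n with
  | zero => exact (hP.1 (hx ⊤ (mem_top 1))).elim
  | succ n ih => exact (hP.2 _ _ hx).elim ih id

/-- Replaces `√I` by `I` in every containment in a radical ideal, in particular in a prime. -/
theorem IsRadical.radical_le_iff {I J : TambaraIdeal T} (hJ : J.IsRadical) :
    I.radical ≤ J ↔ I ≤ J :=
  ⟨I.le_radical.trans, fun h H x ⟨n, _, hx⟩ => isRadical_iff.1 hJ H x n (hx.trans h)⟩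

theorem zero_le (I : TambaraIdeal T) : zero T ≤ I := by
  rintro H x (rfl : x = 0)
  exact Ideal.zero_mem _

theorem IsRadical.nilradical_le {J : TambaraIdeal T} (hJ : J.IsRadical) : nilradical T ≤ J :=
  hJ.radical_le_iff.2 (zero_le J)

theorem vIdeal_radical (I : TambaraIdeal T) : VIdeal I = VIdeal I.radical :=
  Set.ext fun P => P.2.isRadical.radical_le_iff.symm

end TambaraIdeal

open TambaraIdeal

/-- The mutually inverse frame homomorphisms underlying an order isomorphism of frames. -/
def FrameIso.ofOrderIso {A B : Type*} [Order.Frame A] [Order.Frame B] (e : A ≃o B) :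
    FrameIso A B where
  -- Order isomorphisms preserve finite meets and arbitrary joins, so `e` coerces to a frame
  -- homomorphism.
  hom := e
  inv := e.symm
  inv_hom := e.symm_apply_apply
  hom_inv := e.apply_symm_apply

/-! ### Nakaoka spectra along a levelwise surjective morphism. -/

section Spectrum

variable {T : TambaraFunctor.{u} G} {S : TambaraFunctor.{w} G} {φ : TambaraHom T S}
  (hφ : ∀ H, Function.Surjective (φ.app H))

/-- The map on Nakaoka spectra induced by a levelwise surjective morphism. -/
def specComap (Q : SpecNak S) : SpecNak T := ⟨Q.1.comap φ, (isPrime_comap_iff hφ).2 Q.2⟩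

theorem isEmbedding_specComap : Topology.IsEmbedding (specComap hφ) := by
  refine ⟨⟨?_⟩, fun P Q h => ?_⟩
  -- The induced topology is generated by the preimages of the subbasic open sets. The preimage
  -- attached to `x` is the subbasic set attached to `φ x`, so the two generating families agree.
  · refine Eq.trans ?_ induced_generateFrom_eq.symm
    refine congrArg TopologicalSpace.generateFrom (Set.ext fun U => ⟨?_, ?_⟩)
    · rintro ⟨H, y, rfl⟩
      obtain ⟨x, rfl⟩ := hφ H y
      exact ⟨_, ⟨H, x, rfl⟩, rfl⟩
    · rintro ⟨_, ⟨H, x, rfl⟩, rfl⟩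
      exact ⟨H, φ.app H x, rfl⟩
  -- Injectivity: extension recovers a prime from its contraction.
  · have h' : P.1.comap φ = Q.1.comap φ := congrArg Subtype.val h
    exact Subtype.ext (by rw [← extend_comap hφ P.1, h', extend_comap hφ])

/-- A prime containing the kernel is the contraction of its extension, so primality descends to that
extension. -/
theorem range_specComap : Set.range (specComap hφ) = VIdeal ((zero S).comap φ) := by
  ext P
  constructor
  · rintro ⟨Q, rfl⟩
    exact comap_mono (zero_le Q.1)
  · intro hP
    have h : (P.1.extend φ).comap φ = P.1 := comap_extend hφ hP
    exact ⟨⟨P.1.extend φ, (isPrime_comap_iff hφ).1 (by rw [h]; exact P.2)⟩, Subtype.ext h⟩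

end Spectrum

/-! ### Specialization to `T / I` and `T_red`. -/

section Quotient

variable {T : TambaraFunctor.{u} G} (I : TambaraIdeal T)

theorem proj_surjective (H : Subgroup G) : Function.Surjective ((T.proj I).app H) :=
  Ideal.Quotient.mk_surjective

/-- Identifies the kernel of the projection, turning conditions on the kernel into conditions on
`I`. -/
theorem comap_proj_zero : (zero (T.quot I)).comap (T.proj I) = I := by
  ext H x
  exact Ideal.Quotient.eq_zero_iff_mem

variable {I}

theorem le_comap_proj (J : TambaraIdeal (T.quot I)) : I ≤ J.comap (T.proj I) :=
  (comap_proj_zero I).ge.trans (comap_mono (zero_le J))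

theorem comap_extend_proj {J : TambaraIdeal T} (hJ : I ≤ J) :
    (J.extend (T.proj I)).comap (T.proj I) = J :=
  comap_extend (proj_surjective I) ((comap_proj_zero I).le.trans hJ)

/-- Because of this, the outer radical in the formula `J ↦ √(π_* J)` changes nothing. -/
theorem isRadical_extend_proj {J : TambaraIdeal T} (hJ : J.IsRadical) (hI : I ≤ J) :
    (J.extend (T.proj I)).IsRadical := by
  rwa [← isRadical_comap_iff (proj_surjective I), comap_extend_proj hI]

variable (I)

/-- Radical ideals of `T / I` are the radical ideals of `T` containing `√I`. -/
def radIdQuotOrderIso : RadId (T.quot I) ≃o UpRad I where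
  toFun J := ⟨⟨J.1.comap (T.proj I), (isRadical_comap_iff (proj_surjective I)).2 J.2⟩,
    ((isRadical_comap_iff (proj_surjective I)).2 J.2).radical_le_iff.2 (le_comap_proj J.1)⟩
  invFun J := ⟨J.1.1.extend (T.proj I), isRadical_extend_proj J.1.2 (I.le_radical.trans J.2)⟩
  left_inv J := Subtype.ext (extend_comap (proj_surjective I) J.1)
  right_inv J := Subtype.ext (Subtype.ext (comap_extend_proj (I.le_radical.trans J.2)))
  map_rel_iff' := comap_le_comap_iff (proj_surjective I)

variable (T)

/-- Radical ideals of `T_red` are the radical ideals of `T`. -/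
def radIdRedOrderIso : RadId T.red ≃o RadId T where
  -- `T.red` and `T.projRed` unfold to the quotient by `nilradical T` and its projection, so the
  -- lemmas on `T.proj` apply directly.
  toFun J := ⟨J.1.comap T.projRed, (isRadical_comap_iff (proj_surjective _)).2 J.2⟩
  invFun J := ⟨J.1.extend T.projRed, isRadical_extend_proj J.2 J.2.nilradical_le⟩
  left_inv J := Subtype.ext (extend_comap (proj_surjective _) J.1)
  right_inv J := Subtype.ext (comap_extend_proj J.2.nilradical_le)
  map_rel_iff' := comap_le_comap_iff (proj_surjective _)

theorem range_specComap_proj : Set.range (specComap (proj_surjective I)) = VIdeal I := by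
  rw [range_specComap, comap_proj_zero]

theorem surjective_specComap_projRed :
    Function.Surjective (specComap (proj_surjective (nilradical T))) := by
  rw [← Set.range_eq_univ, range_specComap_proj]
  -- Every prime is radical, hence contains `√0`.
  exact Set.eq_univ_of_forall fun P => P.2.isRadical.nilradical_le

end Quotient

end Tambara

theorem mainTheorem9 {G : Type v} [Group G] [Finite G] (T : TambaraFunctor.{u, v} G) :
    (∀ I : TambaraIdeal T,
      (∃ e : FrameIso (RadId (T.quot I)) (UpRad I),
        (∀ J : RadId (T.quot I), (e.hom J).1.1 = J.1.comap (T.proj I)) ∧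
        (∀ J : UpRad I, (e.inv J).1 = (J.1.1.extend (T.proj I)).radical)) ∧
      VIdeal I = VIdeal I.radical ∧
      (∃ h : SpecNak (T.quot I) ≃ₜ VIdeal I,
        ∀ Q : SpecNak (T.quot I), (h Q).1.1 = Q.1.comap (T.proj I))) ∧
    (∃ e : FrameIso (RadId T.red) (RadId T),
      (∀ J : RadId T.red, (e.hom J).1 = J.1.comap T.projRed) ∧
      (∀ J : RadId T, (e.inv J).1 = (J.1.extend T.projRed).radical)) ∧
    (∃ h : SpecNak T.red ≃ₜ SpecNak T,
      ∀ Q : SpecNak T.red, (h Q).1 = Q.1.comap T.projRed) := by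
  refine ⟨fun I => ⟨⟨.ofOrderIso (radIdQuotOrderIso I), fun _ => rfl, fun J => ?_⟩,
    TambaraIdeal.vIdeal_radical I, ?_⟩,
    ⟨.ofOrderIso (radIdRedOrderIso T), fun _ => rfl, fun J => ?_⟩, ?_⟩
  -- The inverse was built as plain extension. `IsRadical K` unfolds to `K = K.radical`, which is
  -- the required equation.
  · exact isRadical_extend_proj J.1.2 (I.le_radical.trans J.2)
  · exact ⟨(isEmbedding_specComap (proj_surjective I)).toHomeomorph.trans
      (Homeomorph.setCongr (range_specComap_proj T I)), fun _ => rfl⟩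
  · exact isRadical_extend_proj J.2 J.2.nilradical_le
  · exact ⟨(isEmbedding_specComap (proj_surjective (nilradical T))).toHomeomorphOfSurjective
      (surjective_specComap_projRed T), fun _ => rfl⟩
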